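/- Let $a>0$, $E\in[0,1]$ and $\kappa\in\mathbb Z+\tfrac12$. For a parameter $\lambda\in\mathbb R$ consider the $\Theta$-system $$\dot\theta=\sin\theta,\qquad \dot\Theta=-2a\sin\theta\cos\theta\cos\Theta+2aE\sin^2\theta\sin\Theta-2\kappa\sin\Theta+2\lambda\sin\theta$$ on the cylinder $[0,\pi]\times\mathbb S^1$ ($\mathbb S^1=\mathbb R/2\pi\mathbb Z$), with universal cover $[0,\pi]\times\mathbb R$. A non-boundary orbit is one whose image is not contained in $\{\theta=0\}$ or in $\{\theta=\pi\}$. Put $S^-=(0,0)$, $S^+=(\pi,-\pi)$, $N^+=(\pi,0)$ if $\kappa>0$, and $S^-=(0,\pi)$, $S^+=(\pi,0)$, $N^+=(\pi,\pi)$ if $\kappa<0$; $S^\pm$ are saddles and $N^+$ is a sink. Let $\widetilde{\mathcal W}^-_\lambda$ (the unstable manifold of $S^-$) be the non-boundary orbit in the universal cover, unique up to a translation of time, whose $\alpha$-limit point is $S^-$. It is called a saddles connector if the $\omega$-limit point of its projection to the cylinder is $S^+$. It has winding number $N\in\mathbb Z$ if its $\omega$-limit point in the universal cover is $N^+-(0,2\pi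 N)$ or $S^+-(0,2\pi N)$. **Theorem.** For every integer $N\le-1$ there is a unique $\lambda_N\in\mathbb R$ such that $\widetilde{\mathcal W}^-_{\lambda_N}$ is a saddles connector with winding number $N$. Moreover $\lambda_N\ge\lambda_{N+1}$ (for $N=-1$: $\lambda_{-1}\ge\lambda_0$ for any $\lambda_0$ such that $\widetilde{\mathcal W}^-_{\lambda_0}$ is a saddles connector with winding number $0$), and * if $\kappa>0$, then $(2N+1)\left(\tfrac12+\kappa\right)-2a\le-\lambda_N\le-\tfrac12-\kappa+a$; * if $\kappa<0$, then $(2N+1)\left(\tfrac12-\kappa\right)-2a\le-\lambda_N\le-\tfrac12+\kappa+a$. -/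

import Mathlib

open Filter Topology

noncomputable section

/-- The vector field of the `Θ`-system on the universal cover `[0, π] × ℝ` of the finite cylinder
`[0, π] × 𝕊¹`: `θ' = sin θ`, `Θ' = g(θ, Θ)`; a point is `p = (θ, Θ)`. -/
def thetaField (a E κ lam : ℝ) (p : ℝ × ℝ) : ℝ × ℝ :=
  (Real.sin p.1,
    -2 * a * Real.sin p.1 * Real.cos p.1 * Real.cos p.2
      + 2 * a * E * Real.sin p.1 ^ 2 * Real.sin p.2
      - 2 * κ * Real.sin p.2 + 2 * lam * Real.sin p.1)

/-- The `Θ`-coordinate of the left saddle `S⁻ = (0, s⁻)` in the fundamental domain, which is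
`[0, π] × [-π, π)` for `κ > 0` and `[0, π] × [0, 2π)` for `κ < 0`. -/
def saddleLeft (κ : ℝ) : ℝ := if 0 < κ then 0 else Real.pi

/-- The `Θ`-coordinate of the right saddle `S⁺ = (π, s⁺)` in the fundamental domain. -/
def saddleRight (κ : ℝ) : ℝ := if 0 < κ then -Real.pi else 0

/-- The `Θ`-coordinate of the right node (sink) `N⁺ = (π, n⁺)` in the fundamental domain. -/
def nodeRight (κ : ℝ) : ℝ := if 0 < κ then 0 else Real.pi

/-- A non-boundary orbit of the `Θ`-system in the universal cover `[0, π] × ℝ`: a global integral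
curve whose image is not completely contained in one of the two boundary lines. -/
structure IsNonBoundaryOrbit (a E κ lam : ℝ) (γ : ℝ → ℝ × ℝ) : Prop where
  hasDerivAt : ∀ τ, HasDerivAt γ (thetaField a E κ lam (γ τ)) τ
  mem_cover : ∀ τ, (γ τ).1 ∈ Set.Icc 0 Real.pi
  not_left : ¬ ∀ τ, (γ τ).1 = 0
  not_right : ¬ ∀ τ, (γ τ).1 = Real.pi

/-- A non-boundary orbit in the universal cover whose `α`-limit point is the saddle `S⁻` of the
fundamental domain. -/
def EmanatesFromSaddle (a E κ lam : ℝ) (γ : ℝ → ℝ × ℝ) : Prop :=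
  IsNonBoundaryOrbit a E κ lam γ ∧ Tendsto γ atBot (𝓝 (0, saddleLeft κ))

/-- `γ` parametrizes the (lifted) unstable manifold of `S⁻`: it is the orbit emanating from `S⁻`,
unique up to a translation of the time parameter. -/
def IsUnstableManifold (a E κ lam : ℝ) (γ : ℝ → ℝ × ℝ) : Prop :=
  EmanatesFromSaddle a E κ lam γ ∧
    ∀ γ', EmanatesFromSaddle a E κ lam γ' → ∃ c : ℝ, ∀ τ, γ' τ = γ (τ + c)

/-- The projection to the cylinder `[0, π] × 𝕊¹` of the orbit `γ` has the saddle `S⁺` as its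
`ω`-limit point. -/
def EndsAtSaddle (κ : ℝ) (γ : ℝ → ℝ × ℝ) : Prop :=
  Tendsto (fun τ => ((γ τ).1, ((γ τ).2 : Real.Angle))) atTop
    (𝓝 (Real.pi, (saddleRight κ : Real.Angle)))

/-- The winding number of an orbit `γ` in the universal cover which starts at `S⁻` is `N`: its
`ω`-limit point is the copy `(π, n⁺ - 2πN)` of `N⁺` or the copy `(π, s⁺ - 2πN)` of `S⁺`. -/
def HasWindingNumber (κ : ℝ) (γ : ℝ → ℝ × ℝ) (N : ℤ) : Prop :=
  Tendsto γ atTop (𝓝 (Real.pi, nodeRight κ - 2 * Real.pi * N)) ∨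
    Tendsto γ atTop (𝓝 (Real.pi, saddleRight κ - 2 * Real.pi * N))

/-- For the parameter value `lam`, the unstable manifold of `S⁻` is a saddles connector with
winding number `N`. -/
def IsSaddlesConnectorWithWinding (a E κ lam : ℝ) (N : ℤ) : Prop :=
  ∃ γ, IsUnstableManifold a E κ lam γ ∧ EndsAtSaddle κ γ ∧ HasWindingNumber κ γ N

end

/-! Since θ evolves on its own, every non-boundary orbit is, up to a time shift, given by a solution
u of a scalar non-autonomous equation along one fixed θ(t) (`polarAngle`), normalized by θ(0) = π/2.
Measuring Θ from the left saddle reduces everything to κ > 0, at the price of a possibly negative a.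

For each λ there is exactly one solution u_λ with limit 0 at -∞. Differences of solutions satisfy a
linear equation whose coefficient is nonpositive near -∞ because κ > 0, so differential inequalities
can be integrated from -∞ (`nonneg_of_tendsto_atBot`, `pos_of_tendsto_atBot`): u_λ is unique,
strictly increasing in λ, and comparable with sub- and supersolutions.

Reversing time and sending Θ to T - Θ, with T an odd multiple of π, preserves the equation. By
uniqueness, u_λ tends to T at +∞ exactly when u_λ(0) = T/2 (`IsUnstableSolution.tendsto_atTop_iff`).
A connector of winding number N thus amounts to u_λ(0) = kπ/2 with k = -2N - 1. Strict monotonicity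
gives uniqueness of λ_N and the ordering; continuity of u_λ(0) and comparison with θ and kθ give
existence and the bounds (`exists_parameter`). -/

namespace ThetaSystem

/-! ### Global existence and linear comparison for scalar equations -/

/-- A scalar ODE whose right-hand side is bounded and globally Lipschitz has global solutions. -/
theorem exists_global_solution {f : ℝ → ℝ → ℝ} {K L : NNReal} (hlip : ∀ t, LipschitzWith K (f t))
    (hcont : ∀ x, Continuous fun t => f t x) (hb : ∀ t x, |f t x| ≤ L) (t₀ x₀ : ℝ) :
    ∃ α : ℝ → ℝ, α t₀ = x₀ ∧ ∀ t, HasDerivAt α (f t (α t)) t := by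
  have key : ∀ n : ℕ, ∃ α : ℝ → ℝ, α t₀ = x₀ ∧
      ∀ t ∈ Set.Ioo (t₀ - (n + 1)) (t₀ + (n + 1)), HasDerivAt α (f t (α t)) t := by
    intro n
    have ht₀ : t₀ ∈ Set.Icc (t₀ - ((n : ℝ) + 1)) (t₀ + (n + 1)) := by
      constructor <;> linarith [(Nat.cast_nonneg n : (0 : ℝ) ≤ n)]
    -- As |f| ≤ L, a solution stays within L (n + 1) of x₀ during time n + 1, so windows of every
    -- length are admissible.
    have hpl : IsPicardLindelof f (⟨t₀, ht₀⟩ : Set.Icc (t₀ - ((n : ℝ) + 1)) (t₀ + (n + 1))) x₀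
        (L * (n + 1)) 0 L K :=
      { lipschitzOnWith := fun t _ => (hlip t).lipschitzOnWith
        continuousOn := fun x _ => (hcont x).continuousOn
        norm_le := fun t _ x _ => hb t x
        mul_max_le := by simp }
    obtain ⟨α, h0, hα⟩ := hpl.exists_eq_forall_mem_Icc_hasDerivWithinAt₀
    exact ⟨α, h0, fun t ht => (hα t (Set.Ioo_subset_Icc_self ht)).hasDerivAt
      (Icc_mem_nhds ht.1 ht.2)⟩
  choose A hA0 hA using key
  have agree : ∀ m n : ℕ, m ≤ n → ∀ s ∈ Set.Ioo (t₀ - ((m : ℝ) + 1)) (t₀ + (m + 1)),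
      A m s = A n s := by
    intro m n hmn s hs
    have hmn' : (m : ℝ) ≤ n := by exact_mod_cast hmn
    have hm : (0 : ℝ) ≤ m := Nat.cast_nonneg m
    refine ODE_solution_unique_of_mem_Ioo (v := f) (K := K) (s := fun _ => Set.univ) (t₀ := t₀)
      (fun t _ => (hlip t).lipschitzOnWith) ⟨by linarith, by linarith⟩
      (fun t ht => ⟨hA m t ht, trivial⟩)
      (fun t ht => ⟨hA n t ⟨by linarith [ht.1], by linarith [ht.2]⟩, trivial⟩)
      (by rw [hA0, hA0]) hs
  -- Each time uses the first window containing it. Times near t use the same window or a smaller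
  -- one, and `agree` identifies the two solutions.
  refine ⟨fun t => A ⌊|t - t₀|⌋₊ t, by simp [hA0], fun t => ?_⟩
  have hlt : |t - t₀| < (⌊|t - t₀|⌋₊ : ℝ) + 1 := Nat.lt_floor_add_one _
  have hmem : ∀ s : ℝ, ∀ n : ℕ, |s - t₀| < (n : ℝ) + 1 →
      s ∈ Set.Ioo (t₀ - ((n : ℝ) + 1)) (t₀ + (n + 1)) := by
    intro s n hs
    rw [abs_lt] at hs
    exact ⟨by linarith, by linarith⟩
  refine (hA ⌊|t - t₀|⌋₊ t (hmem t _ hlt)).congr_of_eventuallyEq ?_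
  have hnear : ∀ᶠ s in 𝓝 t, |s - t₀| < (⌊|t - t₀|⌋₊ : ℝ) + 1 :=
    (by fun_prop : Continuous fun s : ℝ => |s - t₀|).continuousAt.eventually_lt
      continuousAt_const hlt
  filter_upwards [hnear] with s hs
  refine agree _ _ ?_ s (hmem s _ (Nat.lt_floor_add_one _))
  have h : ⌊|s - t₀|⌋₊ < ⌊|t - t₀|⌋₊ + 1 := by
    rw [Nat.floor_lt (abs_nonneg _)]
    exact_mod_cast hs
  omega

/-- An integrating factor for the scalar linear equation `D' = c D + g`. -/
theorem exists_integrating_factor {c g D : ℝ → ℝ} (hc : Continuous c)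
    (hD : ∀ t, HasDerivAt D (c t * D t + g t) t) :
    ∃ P : ℝ → ℝ, (∀ t, 0 < P t) ∧ (∀ t, HasDerivAt P (-c t * P t) t) ∧
      ∀ t, HasDerivAt (fun s => P s * D s) (P t * g t) t := by
  have hI : ∀ t, HasDerivAt (fun s => ∫ x in (0 : ℝ)..s, c x) (c t) t := fun t =>
    hc.integral_hasStrictDerivAt 0 t |>.hasDerivAt
  have hP : ∀ t, HasDerivAt (fun s => Real.exp (-∫ x in (0 : ℝ)..s, c x))
      (-c t * Real.exp (-∫ x in (0 : ℝ)..t, c x)) t := fun t => by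
    have := (hI t).neg.exp
    convert! this using 1
    rw [Pi.neg_apply]
    ring
  refine ⟨_, fun t => Real.exp_pos _, hP, fun t => ?_⟩
  convert! (hP t).mul (hD t) using 1
  ring

theorem nonneg_of_nonneg_left {c g D : ℝ → ℝ} (hc : Continuous c)
    (hD : ∀ t, HasDerivAt D (c t * D t + g t) t) {s t : ℝ} (hst : s ≤ t)
    (hg : ∀ x ∈ Set.Icc s t, 0 ≤ g x) (hs : 0 ≤ D s) : 0 ≤ D t := by
  obtain ⟨P, hP, -, hG⟩ := exists_integrating_factor hc hD
  have hmono : MonotoneOn (fun s => P s * D s) (Set.Icc s t) :=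
    monotoneOn_of_hasDerivWithinAt_nonneg (convex_Icc s t)
      (fun x _ => (hG x).continuousAt.continuousWithinAt)
      (fun x _ => (hG x).hasDerivWithinAt)
      (fun x hx => mul_nonneg (hP x).le (hg x (interior_subset hx)))
  have h := hmono (Set.left_mem_Icc.2 hst) (Set.right_mem_Icc.2 hst) hst
  exact nonneg_of_mul_nonneg_right ((mul_nonneg (hP s).le hs).trans h) (hP t)

/-- Where c ≤ 0 the factor P is nondecreasing, hence bounded near -∞, so P D inherits the limit 0 of
D. This lets -∞ play the role of the initial time. -/
theorem exists_monotone_factor {c g D : ℝ → ℝ} (hc : Continuous c)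
    (hD : ∀ t, HasDerivAt D (c t * D t + g t) t) (hneg : ∀ᶠ t in atBot, c t ≤ 0)
    (hlim : Tendsto D atBot (𝓝 0)) :
    ∃ P : ℝ → ℝ, (∀ t, 0 < P t) ∧ (∀ t, HasDerivAt (fun s => P s * D s) (P t * g t) t) ∧
      Tendsto (fun s => P s * D s) atBot (𝓝 0) := by
  obtain ⟨P, hP, hP', hG⟩ := exists_integrating_factor hc hD
  obtain ⟨t₀, ht₀⟩ := eventually_atBot.1 hneg
  have hmono : MonotoneOn P (Set.Iic t₀) :=
    monotoneOn_of_hasDerivWithinAt_nonneg (convex_Iic t₀)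
      (fun x _ => (hP' x).continuousAt.continuousWithinAt)
      (fun x _ => (hP' x).hasDerivWithinAt)
      (fun x hx => mul_nonneg (neg_nonneg.2 (ht₀ x (interior_subset (s := Set.Iic t₀) hx))) (hP x).le)
  refine ⟨P, hP, hG, ?_⟩
  have h0 : Tendsto (fun s => P t₀ * |D s|) atBot (𝓝 0) := by
    simpa using hlim.abs.const_mul (P t₀)
  refine squeeze_zero_norm' ?_ h0
  filter_upwards [eventually_le_atBot t₀] with s hs
  rw [Real.norm_eq_abs, abs_mul, abs_of_pos (hP s)]
  exact mul_le_mul_of_nonneg_right (hmono hs Set.self_mem_Iic hs) (abs_nonneg _)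

theorem nonneg_of_tendsto_atBot {c g D : ℝ → ℝ} (hc : Continuous c)
    (hD : ∀ t, HasDerivAt D (c t * D t + g t) t) (hneg : ∀ᶠ t in atBot, c t ≤ 0)
    (hlim : Tendsto D atBot (𝓝 0)) (hg : ∀ t, 0 ≤ g t) (t : ℝ) : 0 ≤ D t := by
  obtain ⟨P, hP, hG, hl⟩ := exists_monotone_factor hc hD hneg hlim
  have hmono : Monotone fun s => P s * D s := monotone_of_hasDerivAt_nonneg hG
    fun x => mul_nonneg (hP x).le (hg x)
  exact nonneg_of_mul_nonneg_right (hmono.le_of_tendsto hl t) (hP t)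

theorem pos_of_tendsto_atBot {c g D : ℝ → ℝ} (hc : Continuous c)
    (hD : ∀ t, HasDerivAt D (c t * D t + g t) t) (hneg : ∀ᶠ t in atBot, c t ≤ 0)
    (hlim : Tendsto D atBot (𝓝 0)) (hg : ∀ t, 0 < g t) (t : ℝ) : 0 < D t := by
  obtain ⟨P, hP, hG, hl⟩ := exists_monotone_factor hc hD hneg hlim
  have hmono : StrictMono fun s => P s * D s := strictMono_of_hasDerivAt_pos hG
    fun x => mul_pos (hP x) (hg x)
  have h := hmono (sub_one_lt t)
  exact pos_of_mul_pos_right ((hmono.monotone.le_of_tendsto hl _).trans_lt h) (hP t).le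

/-! ### The θ-equation -/

/-- The solution of `θ' = sin θ` with `θ(0) = π / 2`. -/
noncomputable def polarAngle (t : ℝ) : ℝ := 2 * Real.arctan (Real.exp t)

theorem polarAngle_zero : polarAngle 0 = Real.pi / 2 := by
  simp [polarAngle]; ring

theorem polarAngle_neg (t : ℝ) : polarAngle (-t) = Real.pi - polarAngle t := by
  rw [polarAngle, polarAngle, Real.exp_neg, Real.arctan_inv_of_pos (Real.exp_pos t)]
  ring

theorem polarAngle_pos (t : ℝ) : 0 < polarAngle t :=
  mul_pos two_pos (Real.arctan_pos.2 (Real.exp_pos t))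

theorem polarAngle_lt_pi (t : ℝ) : polarAngle t < Real.pi := by
  have := Real.arctan_lt_pi_div_two (Real.exp t)
  rw [polarAngle]; linarith

theorem sin_polarAngle_pos (t : ℝ) : 0 < Real.sin (polarAngle t) :=
  Real.sin_pos_of_pos_of_lt_pi (polarAngle_pos t) (polarAngle_lt_pi t)

theorem hasDerivAt_polarAngle (t : ℝ) :
    HasDerivAt polarAngle (Real.sin (polarAngle t)) t := by
  have h := ((Real.hasDerivAt_exp t).arctan).const_mul 2
  convert! h using 1
  have h1 : (0 : ℝ) < 1 + Real.exp t ^ 2 := by positivity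
  rw [polarAngle, Real.sin_two_mul, Real.sin_arctan, Real.cos_arctan]
  have h2 := Real.mul_self_sqrt h1.le
  have h3 : Real.sqrt (1 + Real.exp t ^ 2) ≠ 0 := (Real.sqrt_pos.2 h1).ne'
  field_simp
  rw [Real.sq_sqrt h1.le]

theorem continuous_polarAngle : Continuous polarAngle := by
  unfold polarAngle; fun_prop

theorem strictMono_polarAngle : StrictMono polarAngle :=
  strictMono_of_hasDerivAt_pos hasDerivAt_polarAngle sin_polarAngle_pos

theorem tendsto_polarAngle_atBot : Tendsto polarAngle atBot (𝓝 0) := by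
  have h := (Real.continuous_arctan.tendsto 0).comp Real.tendsto_exp_atBot
  have h2 : Tendsto (fun t => 2 * Real.arctan (Real.exp t)) atBot (𝓝 0) := by
    simpa using h.const_mul 2
  exact h2

theorem tendsto_polarAngle_atTop : Tendsto polarAngle atTop (𝓝 Real.pi) := by
  have h := tendsto_polarAngle_atBot.comp tendsto_neg_atTop_atBot
  have h2 := h.const_sub Real.pi
  simpa [Function.comp_def, polarAngle_neg] using h2

theorem exists_polarAngle_eq {x : ℝ} (h0 : 0 < x) (hπ : x < Real.pi) :
    ∃ c, polarAngle c = x := by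
  refine ⟨Real.log (Real.tan (x / 2)), ?_⟩
  have h : 0 < Real.tan (x / 2) :=
    Real.tan_pos_of_pos_of_lt_pi_div_two (by linarith) (by linarith)
  rw [polarAngle, Real.exp_log h, Real.arctan_tan (by linarith) (by linarith)]
  ring

theorem lipschitzWith_sin : LipschitzWith 1 Real.sin :=
  lipschitzWith_of_nnnorm_deriv_le Real.differentiable_sin fun x => by
    rw [Real.deriv_sin, ← NNReal.coe_le_coe]
    simpa using Real.abs_cos_le_one x

theorem eq_of_sin_ode {x y : ℝ → ℝ} (hx : ∀ t, HasDerivAt x (Real.sin (x t)) t)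
    (hy : ∀ t, HasDerivAt y (Real.sin (y t)) t) (h : x 0 = y 0) : x = y :=
  ODE_solution_unique_univ (v := fun _ => Real.sin) (K := 1) (s := fun _ => Set.univ) (t₀ := 0)
    (fun _ => lipschitzWith_sin.lipschitzOnWith) (fun t => ⟨hx t, trivial⟩)
    (fun t => ⟨hy t, trivial⟩) h

/-- A solution equal to 0 or π at one time is constant by uniqueness; any other is interior at time
0 and agrees there with a shift of `polarAngle`. -/
theorem exists_eq_polarAngle_shift {x : ℝ → ℝ} (hx : ∀ t, HasDerivAt x (Real.sin (x t)) t)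
    (hmem : ∀ t, x t ∈ Set.Icc 0 Real.pi) (h0 : ¬ ∀ t, x t = 0) (hπ : ¬ ∀ t, x t = Real.pi) :
    ∃ c, ∀ t, x t = polarAngle (t + c) := by
  have hconst : ∀ z : ℝ, Real.sin z = 0 → x 0 = z → ∀ t, x t = z := by
    intro z hz hxz t
    have := eq_of_sin_ode hx (y := fun _ => z) (fun t => by
      simpa [hz] using hasDerivAt_const t z) hxz
    exact congrFun this t
  have hpos : 0 < x 0 := lt_of_le_of_ne (hmem 0).1
    fun h => h0 (hconst 0 Real.sin_zero h.symm)
  have hlt : x 0 < Real.pi := lt_of_le_of_ne (hmem 0).2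
    fun h => hπ (hconst _ Real.sin_pi h)
  obtain ⟨c, hc⟩ := exists_polarAngle_eq hpos hlt
  refine ⟨c, fun t => congrFun (eq_of_sin_ode hx
    (y := fun t => polarAngle (t + c)) (fun t => ?_) (by simp [hc])) t⟩
  exact (hasDerivAt_polarAngle (t + c)).comp_add_const t c

/-! ### The Θ-equation: divided differences and bounds -/

/-- The right-hand side of the `Θ`-equation along `θ = polarAngle t`. -/
noncomputable def angularRate (a E κ lam t y : ℝ) : ℝ :=
  (thetaField a E κ lam (polarAngle t, y)).2

/-- The divided difference of `angularRate` in its last variable. -/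
noncomputable def rateSlope (a E κ t u v : ℝ) : ℝ :=
  Real.sinc ((v - u) / 2) *
    (2 * a * Real.sin (polarAngle t) * Real.cos (polarAngle t) * Real.sin ((u + v) / 2)
      + (2 * a * E * Real.sin (polarAngle t) ^ 2 - 2 * κ) * Real.cos ((u + v) / 2))

/-- Sum-to-product formulas; `Real.sinc` keeps the quotient continuous where u = v. -/
theorem angularRate_sub (a E κ lam t u v : ℝ) :
    angularRate a E κ lam t v - angularRate a E κ lam t u = rateSlope a E κ t u v * (v - u) := by
  have hs : Real.sinc ((v - u) / 2) * (v - u) = 2 * Real.sin ((v - u) / 2) := by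
    rcases eq_or_ne ((v - u) / 2) 0 with h | h
    · have : v - u = 0 := by linarith
      simp [this]
    · rw [Real.sinc_of_ne_zero h]
      have : v - u ≠ 0 := fun h' => h (by rw [h']; simp)
      field_simp
  have h1 := Real.cos_sub_cos v u
  have h2 := Real.sin_sub_sin v u
  rw [add_comm v u] at h1 h2
  have e : rateSlope a E κ t u v * (v - u) = Real.sinc ((v - u) / 2) * (v - u) *
    (2 * a * Real.sin (polarAngle t) * Real.cos (polarAngle t) * Real.sin ((u + v) / 2)
      + (2 * a * E * Real.sin (polarAngle t) ^ 2 - 2 * κ) * Real.cos ((u + v) / 2)) := by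
    rw [rateSlope]; ring
  rw [e, hs]
  simp only [angularRate, thetaField]
  linear_combination (-2 * a * Real.sin (polarAngle t) * Real.cos (polarAngle t)) * h1 +
    (2 * a * E * Real.sin (polarAngle t) ^ 2 - 2 * κ) * h2

theorem continuous_rateSlope (a E κ : ℝ) {u v : ℝ → ℝ} (hu : Continuous u) (hv : Continuous v) :
    Continuous fun t => rateSlope a E κ t (u t) (v t) := by
  have h := Real.continuous_sinc.comp ((hv.sub hu).div_const 2)
  have hp := continuous_polarAngle
  unfold rateSlope
  exact h.mul (by fun_prop)

variable {a E κ lam : ℝ}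

/-- Cauchy–Schwarz for (c, E s) and (-y, x), the first of norm at most 1 and the second of norm 1.
-/
theorem abs_mul_add_le {a E s c x y : ℝ} (hE : E ∈ Set.Icc (0 : ℝ) 1) (h1 : s ^ 2 + c ^ 2 = 1)
    (h2 : x ^ 2 + y ^ 2 = 1) : |a * (-c * y + E * s * x)| ≤ |a| := by
  rw [abs_mul]
  refine mul_le_of_le_one_right (abs_nonneg _) ?_
  rw [abs_le_one_iff_mul_self_le_one]
  have hE2 : E ^ 2 ≤ 1 := by nlinarith [hE.1, hE.2]
  nlinarith [sq_nonneg (c * x + E * s * y), mul_nonneg (sub_nonneg.2 hE2) (sq_nonneg s)]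

/-- The parameter `lam` enters `angularRate` together with a perturbation of size at most `|a|`. -/
theorem angularRate_eq (a E κ lam t y : ℝ) :
    angularRate a E κ lam t y = -2 * κ * Real.sin y + 2 * Real.sin (polarAngle t) *
      (lam + a * (-Real.cos (polarAngle t) * Real.cos y
        + E * Real.sin (polarAngle t) * Real.sin y)) := by
  simp only [angularRate, thetaField]; ring

theorem angularRate_le (hE : E ∈ Set.Icc (0 : ℝ) 1) (t y : ℝ) :
    angularRate a E κ lam t y ≤
      -2 * κ * Real.sin y + 2 * Real.sin (polarAngle t) * (lam + |a|) := by
  rw [angularRate_eq]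
  have h := (abs_le.1 (abs_mul_add_le (a := a) hE (Real.sin_sq_add_cos_sq (polarAngle t))
    (Real.sin_sq_add_cos_sq y))).2
  have hs := sin_polarAngle_pos t
  gcongr

theorem le_angularRate (hE : E ∈ Set.Icc (0 : ℝ) 1) (t y : ℝ) :
    -2 * κ * Real.sin y + 2 * Real.sin (polarAngle t) * (lam - |a|) ≤
      angularRate a E κ lam t y := by
  rw [angularRate_eq]
  have h := (abs_le.1 (abs_mul_add_le (a := a) hE (Real.sin_sq_add_cos_sq (polarAngle t))
    (Real.sin_sq_add_cos_sq y))).1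
  have hs := sin_polarAngle_pos t
  rw [sub_eq_add_neg]
  gcongr

theorem abs_angularRate_le (hE : E ∈ Set.Icc (0 : ℝ) 1) (t y : ℝ) :
    |angularRate a E κ lam t y| ≤ 2 * |κ| + 2 * (|lam| + |a|) := by
  have h1 := angularRate_le (a := a) (κ := κ) (lam := lam) hE t y
  have h2 := le_angularRate (a := a) (κ := κ) (lam := lam) hE t y
  have hk : |κ * Real.sin y| ≤ |κ| := by
    rw [abs_mul]; exact mul_le_of_le_one_right (abs_nonneg _) (Real.abs_sin_le_one y)
  have hs := sin_polarAngle_pos t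
  have hs1 := Real.sin_le_one (polarAngle t)
  have hl := abs_le.1 (le_refl |lam|)
  have ha := abs_nonneg a
  rw [abs_le] at hk ⊢
  constructor <;> nlinarith [abs_nonneg lam]

theorem abs_rateSlope_le (hE : E ∈ Set.Icc (0 : ℝ) 1) (t u v : ℝ) :
    |rateSlope a E κ t u v| ≤ 2 * |κ| + 2 * |a| := by
  set m := (u + v) / 2
  have h := abs_mul_add_le (a := a) (s := Real.sin (polarAngle t)) (c := Real.cos (polarAngle t))
    (x := Real.cos m) (y := -Real.sin m) hE
    (Real.sin_sq_add_cos_sq (polarAngle t)) (by rw [neg_sq, Real.cos_sq_add_sin_sq])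
  have e : rateSlope a E κ t u v = Real.sinc ((v - u) / 2) *
      (2 * Real.sin (polarAngle t) * (a * (-Real.cos (polarAngle t) * -Real.sin m
        + E * Real.sin (polarAngle t) * Real.cos m)) - 2 * κ * Real.cos m) := by
    rw [rateSlope]; ring
  rw [e, abs_mul]
  refine (mul_le_of_le_one_left (abs_nonneg _) (Real.abs_sinc_le_one _)).trans ?_
  refine (abs_sub _ _).trans ?_
  rw [abs_mul, abs_mul (2 * κ), abs_mul, abs_mul 2 κ, abs_two]
  have h1 := Real.abs_sin_le_one (polarAngle t)
  have h2 := Real.abs_cos_le_one m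
  have h3 := abs_nonneg κ
  have h4 := abs_nonneg a
  nlinarith [abs_nonneg (Real.sin (polarAngle t)), mul_le_mul h1 h (abs_nonneg _) zero_le_one]

/-- At θ = u = v = 0 the slope is -2κ < 0, and it is jointly continuous. Uniformity in u and v later
gives one threshold time for a whole interval of parameters. -/
theorem rateSlope_nonpos_eventually (a E : ℝ) (hκ : 0 < κ) :
    ∃ η > 0, ∀ᶠ t in atBot, ∀ u v : ℝ, |u| ≤ η → |v| ≤ η → rateSlope a E κ t u v ≤ 0 := by
  have hcont : Continuous fun p : ℝ × ℝ × ℝ => Real.sinc ((p.2.2 - p.2.1) / 2) *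
    (2 * a * Real.sin p.1 * Real.cos p.1 * Real.sin ((p.2.1 + p.2.2) / 2)
      + (2 * a * E * Real.sin p.1 ^ 2 - 2 * κ) * Real.cos ((p.2.1 + p.2.2) / 2)) :=
    (Real.continuous_sinc.comp (by fun_prop)).mul (by fun_prop)
  have hev : ∀ᶠ p : ℝ × ℝ × ℝ in 𝓝 0, Real.sinc ((p.2.2 - p.2.1) / 2) *
    (2 * a * Real.sin p.1 * Real.cos p.1 * Real.sin ((p.2.1 + p.2.2) / 2)
      + (2 * a * E * Real.sin p.1 ^ 2 - 2 * κ) * Real.cos ((p.2.1 + p.2.2) / 2)) < 0 :=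
    hcont.continuousAt.eventually_lt continuousAt_const (by simpa using hκ)
  obtain ⟨ε, hε, hball⟩ := Metric.eventually_nhds_iff.1 hev
  refine ⟨ε / 2, half_pos hε, ?_⟩
  filter_upwards [tendsto_polarAngle_atBot.eventually_lt_const hε] with t ht u v hu hv
  refine (hball (y := (polarAngle t, u, v)) ?_).le
  simp only [Prod.dist_eq, Real.dist_eq, Prod.fst_zero, Prod.snd_zero, sub_zero, max_lt_iff,
    abs_of_pos (polarAngle_pos t)]
  exact ⟨ht, by linarith, by linarith⟩

theorem lipschitzWith_angularRate (hE : E ∈ Set.Icc (0 : ℝ) 1) (t : ℝ) :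
    LipschitzWith (2 * ‖κ‖₊ + 2 * ‖a‖₊) (angularRate a E κ lam t) :=
  LipschitzWith.of_dist_le_mul fun x y => by
    rw [Real.dist_eq, Real.dist_eq, angularRate_sub, abs_mul]
    exact mul_le_mul_of_nonneg_right (by simpa using abs_rateSlope_le hE t y x) (abs_nonneg _)

theorem continuous_angularRate (y : ℝ) : Continuous fun t => angularRate a E κ lam t y := by
  have hp := continuous_polarAngle
  unfold angularRate thetaField
  fun_prop

/-! ### Solutions and comparison from -∞ -/

/-- Solutions of the `Θ`-equation along `θ = polarAngle t`. -/
def IsSolution (a E κ lam : ℝ) (u : ℝ → ℝ) : Prop :=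
  ∀ t, HasDerivAt u (angularRate a E κ lam t (u t)) t

theorem exists_solution (hE : E ∈ Set.Icc (0 : ℝ) 1) (t₀ x₀ : ℝ) :
    ∃ u, u t₀ = x₀ ∧ IsSolution a E κ lam u :=
  exists_global_solution (L := 2 * ‖κ‖₊ + 2 * (‖lam‖₊ + ‖a‖₊)) (lipschitzWith_angularRate hE)
    continuous_angularRate (fun t x => by simpa using abs_angularRate_le hE t x) t₀ x₀

theorem IsSolution.continuous {u : ℝ → ℝ} (hu : IsSolution a E κ lam u) : Continuous u :=
  continuous_iff_continuousAt.2 fun t => (hu t).continuousAt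

/-- The linear equation satisfied by the difference of a solution and another function. -/
theorem IsSolution.hasDerivAt_sub {u v v' : ℝ → ℝ} (hu : IsSolution a E κ lam u)
    (hv : ∀ t, HasDerivAt v (v' t) t) (t : ℝ) :
    HasDerivAt (fun s => v s - u s) (rateSlope a E κ t (u t) (v t) * (v t - u t) +
      (v' t - angularRate a E κ lam t (v t))) t := by
  convert! (hv t).sub (hu t) using 1
  rw [← angularRate_sub (lam := lam)]; ring

theorem IsSolution.hasDerivAt_sub' {u v v' : ℝ → ℝ} (hu : IsSolution a E κ lam u)
    (hv : ∀ t, HasDerivAt v (v' t) t) (t : ℝ) :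
    HasDerivAt (fun s => u s - v s) (rateSlope a E κ t (v t) (u t) * (u t - v t) +
      (angularRate a E κ lam t (v t) - v' t)) t := by
  convert! (hu t).sub (hv t) using 1
  rw [← angularRate_sub (lam := lam)]; ring

/-- The forcing vanishes, so the difference times its integrating factor is constant and order is
preserved both forward and backward in time. -/
theorem IsSolution.le_of_le {u v : ℝ → ℝ} (hu : IsSolution a E κ lam u)
    (hv : IsSolution a E κ lam v) {s : ℝ} (h : u s ≤ v s) (t : ℝ) : u t ≤ v t := by
  obtain ⟨P, hP, -, hG⟩ := exists_integrating_factor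
    (continuous_rateSlope a E κ hu.continuous hv.continuous) (hu.hasDerivAt_sub hv)
  have hconst := is_const_of_deriv_eq_zero (fun x => (hG x).differentiableAt)
    (fun x => by rw [(hG x).deriv]; simp) s t
  have h0 : 0 ≤ P t * (v t - u t) := hconst ▸ mul_nonneg (hP s).le (sub_nonneg.2 h)
  exact sub_nonneg.1 (nonneg_of_mul_nonneg_right h0 (hP t))

theorem IsSolution.eq_of_eq {u v : ℝ → ℝ} (hu : IsSolution a E κ lam u)
    (hv : IsSolution a E κ lam v) {s : ℝ} (h : u s = v s) : u = v :=
  funext fun t => le_antisymm (hu.le_of_le hv h.le t) (hv.le_of_le hu h.ge t)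

/-- The solutions tending to the saddle at `Θ = 0`. -/
structure IsUnstableSolution (a E κ lam : ℝ) (u : ℝ → ℝ) : Prop where
  isSolution : IsSolution a E κ lam u
  tendsto : Tendsto u atBot (𝓝 0)

theorem eventually_rateSlope_nonpos (a E : ℝ) (hκ : 0 < κ) {u v : ℝ → ℝ}
    (hu : Tendsto u atBot (𝓝 0)) (hv : Tendsto v atBot (𝓝 0)) :
    ∀ᶠ t in atBot, rateSlope a E κ t (u t) (v t) ≤ 0 := by
  obtain ⟨η, hη, h⟩ := rateSlope_nonpos_eventually a E hκ
  have hu' := (abs_zero (α := ℝ) ▸ hu.abs).eventually_le_const hη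
  have hv' := (abs_zero (α := ℝ) ▸ hv.abs).eventually_le_const hη
  filter_upwards [h, hu', hv'] with t ht h1 h2 using ht _ _ h1 h2

namespace IsUnstableSolution

theorem le_of_supersolution (hκ : 0 < κ) {u v v' : ℝ → ℝ} (hu : IsUnstableSolution a E κ lam u)
    (hv : ∀ t, HasDerivAt v (v' t) t) (hv0 : Tendsto v atBot (𝓝 0))
    (h : ∀ t, angularRate a E κ lam t (v t) ≤ v' t) (t : ℝ) : u t ≤ v t :=
  sub_nonneg.1 <| nonneg_of_tendsto_atBot
    (continuous_rateSlope a E κ hu.isSolution.continuous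
      (continuous_iff_continuousAt.2 fun t => (hv t).continuousAt))
    (hu.isSolution.hasDerivAt_sub hv) (eventually_rateSlope_nonpos a E hκ hu.tendsto hv0)
    (by simpa using hv0.sub hu.tendsto) (fun t => sub_nonneg.2 (h t)) t

theorem ge_of_subsolution (hκ : 0 < κ) {u v v' : ℝ → ℝ} (hu : IsUnstableSolution a E κ lam u)
    (hv : ∀ t, HasDerivAt v (v' t) t) (hv0 : Tendsto v atBot (𝓝 0))
    (h : ∀ t, v' t ≤ angularRate a E κ lam t (v t)) (t : ℝ) : v t ≤ u t :=
  sub_nonneg.1 <| nonneg_of_tendsto_atBot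
    (continuous_rateSlope a E κ
      (continuous_iff_continuousAt.2 fun t => (hv t).continuousAt) hu.isSolution.continuous)
    (hu.isSolution.hasDerivAt_sub' hv) (eventually_rateSlope_nonpos a E hκ hv0 hu.tendsto)
    (by simpa using hu.tendsto.sub hv0) (fun t => sub_nonneg.2 (h t)) t

theorem unique (hκ : 0 < κ) {u v : ℝ → ℝ} (hu : IsUnstableSolution a E κ lam u)
    (hv : IsUnstableSolution a E κ lam v) : u = v :=
  funext fun t => le_antisymm
    (hu.le_of_supersolution hκ hv.isSolution hv.tendsto (fun _ => le_rfl) t)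
    (hu.ge_of_subsolution hκ hv.isSolution hv.tendsto (fun _ => le_rfl) t)

theorem angularRate_sub_param (a E κ lam mu t y : ℝ) :
    angularRate a E κ mu t y - angularRate a E κ lam t y =
      2 * (mu - lam) * Real.sin (polarAngle t) := by
  simp only [angularRate, thetaField]; ring

theorem hasDerivAt_sub_param {mu : ℝ} {u v : ℝ → ℝ} (hu : IsUnstableSolution a E κ lam u)
    (hv : IsUnstableSolution a E κ mu v) (t : ℝ) :
    HasDerivAt (fun s => v s - u s) (rateSlope a E κ t (u t) (v t) * (v t - u t) +
      2 * (mu - lam) * Real.sin (polarAngle t)) t := by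
  rw [← angularRate_sub_param a E κ lam mu t (v t)]
  exact hu.isSolution.hasDerivAt_sub hv.isSolution t

theorem lt_of_lt (hκ : 0 < κ) {mu : ℝ} (hlt : lam < mu) {u v : ℝ → ℝ}
    (hu : IsUnstableSolution a E κ lam u) (hv : IsUnstableSolution a E κ mu v) (t : ℝ) :
    u t < v t :=
  sub_pos.1 <| pos_of_tendsto_atBot
    (continuous_rateSlope a E κ hu.isSolution.continuous hv.isSolution.continuous)
    (hu.hasDerivAt_sub_param hv) (eventually_rateSlope_nonpos a E hκ hu.tendsto hv.tendsto)
    (by simpa using hv.tendsto.sub hu.tendsto)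
    (fun t => mul_pos (mul_pos two_pos (sub_pos.2 hlt)) (sin_polarAngle_pos t)) t

theorem le_of_le (hκ : 0 < κ) {mu : ℝ} (hle : lam ≤ mu) {u v : ℝ → ℝ}
    (hu : IsUnstableSolution a E κ lam u) (hv : IsUnstableSolution a E κ mu v) (t : ℝ) :
    u t ≤ v t := by
  rcases hle.eq_or_lt with rfl | h
  · exact (congrFun (hu.unique hκ hv) t).le
  · exact (hu.lt_of_lt hκ h hv t).le

end IsUnstableSolution

/-! ### Existence of the unstable solution -/

/-- Solutions starting between the barriers `± K θ` stay between them as long as `K θ ≤ π`. -/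
theorem IsSolution.abs_le_barrier (hE : E ∈ Set.Icc (0 : ℝ) 1) (hκ : 0 < κ) {u : ℝ → ℝ}
    (hu : IsSolution a E κ lam u) {K t₁ : ℝ} (hK : 2 * (|lam| + |a|) ≤ K)
    (ht₁ : K * polarAngle t₁ ≤ Real.pi) {s t : ℝ} (hst : s ≤ t) (htt : t ≤ t₁)
    (hs : |u s| ≤ K * polarAngle s) : |u t| ≤ K * polarAngle t := by
  have hK0 : 0 ≤ K := le_trans (by positivity) hK
  have hd : ∀ t, HasDerivAt (fun s => K * polarAngle s) (K * Real.sin (polarAngle t)) t :=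
    fun t => (hasDerivAt_polarAngle t).const_mul K
  have hd' : ∀ t, HasDerivAt (fun s => -(K * polarAngle s)) (-(K * Real.sin (polarAngle t))) t :=
    fun t => (hd t).neg
  have hcp := continuous_polarAngle
  -- As 0 ≤ Kθ ≤ π, the term -2κ sin Θ points inward on both barriers; the choice of K absorbs the
  -- rest.
  have hsin : ∀ x ∈ Set.Icc s t, 0 ≤ Real.sin (K * polarAngle x) := fun x hx =>
    Real.sin_nonneg_of_nonneg_of_le_pi (mul_nonneg hK0 (polarAngle_pos x).le)
      ((mul_le_mul_of_nonneg_left (strictMono_polarAngle.monotone (hx.2.trans htt)) hK0).trans ht₁)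
  have hl := abs_le.1 (le_refl |lam|)
  rw [abs_le] at hs ⊢
  constructor
  · have h := nonneg_of_nonneg_left (continuous_rateSlope a E κ (by fun_prop) hu.continuous)
      (hu.hasDerivAt_sub' hd') hst (fun x hx => ?_) (sub_nonneg.2 hs.1)
    · exact sub_nonneg.1 h
    · have h1 := le_angularRate (a := a) (κ := κ) (lam := lam) hE x (-(K * polarAngle x))
      rw [Real.sin_neg] at h1
      nlinarith [hsin x hx, sin_polarAngle_pos x, mul_nonneg hκ.le (hsin x hx)]
  · have h := nonneg_of_nonneg_left (continuous_rateSlope a E κ hu.continuous (by fun_prop))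
      (hu.hasDerivAt_sub hd) hst (fun x hx => ?_) (sub_nonneg.2 hs.2)
    · exact sub_nonneg.1 h
    · have h1 := angularRate_le (a := a) (κ := κ) (lam := lam) hE x (K * polarAngle x)
      nlinarith [hsin x hx, sin_polarAngle_pos x, mul_nonneg hκ.le (hsin x hx)]

theorem exists_isUnstableSolution (hE : E ∈ Set.Icc (0 : ℝ) 1) (hκ : 0 < κ) (a lam : ℝ) :
    ∃ u, IsUnstableSolution a E κ lam u := by
  set K := 2 * (|lam| + |a|)
  have hK0 : 0 ≤ K := by positivity
  have hlim : Tendsto (fun t => K * polarAngle t) atBot (𝓝 0) := by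
    simpa using tendsto_polarAngle_atBot.const_mul K
  obtain ⟨t₁, ht₁⟩ := (hlim.eventually_le_const Real.pi_pos).exists
  have hb : ∀ s, 0 ≤ K * polarAngle s := fun s => mul_nonneg hK0 (polarAngle_pos s).le
  choose up hup hups using fun s => exists_solution (a := a) (κ := κ) (lam := lam) hE s
    (K * polarAngle s)
  choose lo hlo hlos using fun s => exists_solution (a := a) (κ := κ) (lam := lam) hE s
    (-(K * polarAngle s))
  -- Compare at the later starting time, when the solution started earlier still lies between the
  -- barriers.
  have hord : ∀ s ≤ t₁, ∀ t ≤ t₁, lo s t₁ ≤ up t t₁ := by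
    intro s hs t ht
    rcases le_total s t with hst | hst
    · have h := (hlos s).abs_le_barrier hE hκ le_rfl ht₁ hst ht
        (by rw [hlo, abs_neg, abs_of_nonneg (hb s)])
      exact (hlos s).le_of_le (hups t) (s := t) (by rw [hup]; exact (abs_le.1 h).2) t₁
    · have h := (hups t).abs_le_barrier hE hκ le_rfl ht₁ hst hs
        (by rw [hup, abs_of_nonneg (hb t)])
      exact (hlos s).le_of_le (hups t) (s := s) (by rw [hlo]; exact (abs_le.1 h).1) t₁
  -- The supremum separates the lower from the upper solutions at t₁. The solution through it is
  -- therefore within Kθ of 0 at every s ≤ t₁.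
  set S := (fun s => lo s t₁) '' Set.Iic t₁
  have hbdd : BddAbove S := ⟨up t₁ t₁, by
    rintro _ ⟨s, hs, rfl⟩; exact hord s hs t₁ le_rfl⟩
  obtain ⟨u, hu1, hu⟩ := exists_solution (a := a) (κ := κ) (lam := lam) hE t₁ (sSup S)
  refine ⟨u, hu, squeeze_zero_norm' ?_ hlim⟩
  filter_upwards [eventually_le_atBot t₁] with s hs
  rw [Real.norm_eq_abs, abs_le]
  constructor
  · rw [← hlo]
    exact (hlos s).le_of_le hu (s := t₁) (hu1 ▸ le_csSup hbdd ⟨s, hs, rfl⟩) s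
  · rw [← hup]
    refine hu.le_of_le (hups s) (s := t₁) (hu1 ▸ csSup_le ⟨_, t₁, Set.self_mem_Iic, rfl⟩ ?_) s
    rintro _ ⟨r, hr, rfl⟩
    exact hord r hr s hs

/-! ### Continuity in the parameter -/

/-- The value at time `0` of the unstable solution is Lipschitz in the parameter on bounded
intervals. -/
theorem exists_lipschitz_bound (hE : E ∈ Set.Icc (0 : ℝ) 1) (hκ : 0 < κ) {U : ℝ → ℝ → ℝ}
    (hU : ∀ lam, IsUnstableSolution a E κ lam (U lam)) (l r : ℝ) :
    ∃ C, ∀ lam mu, l ≤ lam → lam ≤ mu → mu ≤ r → U mu 0 - U lam 0 ≤ C * (mu - lam) := by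
  obtain ⟨η, hη, hslope⟩ := rateSlope_nonpos_eventually a E hκ
  have h1 := (abs_zero (α := ℝ) ▸ (hU l).tendsto.abs).eventually_le_const hη
  have h2 := (abs_zero (α := ℝ) ▸ (hU r).tendsto.abs).eventually_le_const hη
  obtain ⟨t₀, ht₀⟩ := eventually_atBot.1 ((hslope.and (h1.and h2)).and (eventually_le_atBot 0))
  have ht₀0 : t₀ ≤ 0 := (ht₀ t₀ le_rfl).2
  set L := 2 * |κ| + 2 * |a| + 1
  refine ⟨2 * (Real.pi + 1) * Real.exp (-L * t₀), fun lam mu hl hlm hr => ?_⟩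
  have hδ : 0 ≤ mu - lam := sub_nonneg.2 hlm
  have hD := (hU lam).hasDerivAt_sub_param (hU mu)
  have hD0 : ∀ t, 0 ≤ U mu t - U lam t := fun t =>
    sub_nonneg.2 ((hU lam).le_of_le hκ hlm (hU mu) t)
  -- Monotonicity in the parameter traps U ν between U l and U r, so t₀ serves all of [l, r].
  have hη' : ∀ ν, l ≤ ν → ν ≤ r → ∀ t ≤ t₀, |U ν t| ≤ η := fun ν h3 h4 t ht => by
    obtain ⟨⟨-, h5, h6⟩, -⟩ := ht₀ t ht
    exact abs_le.2 ⟨(abs_le.1 h5).1.trans ((hU l).le_of_le hκ h3 (hU ν) t),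
      ((hU ν).le_of_le hκ h4 (hU r) t).trans (abs_le.1 h6).2⟩
  -- Up to t₀ the slope term is nonpositive, so the difference grows no faster than 2 (mu - lam) θ.
  have hleft : U mu t₀ - U lam t₀ ≤ 2 * (mu - lam) * Real.pi := by
    have hF : ∀ t, HasDerivAt
        (fun s => 2 * (mu - lam) * polarAngle s - (U mu s - U lam s))
        (-(rateSlope a E κ t (U lam t) (U mu t) * (U mu t - U lam t))) t := fun t => by
      convert! ((hasDerivAt_polarAngle t).const_mul (2 * (mu - lam))).sub (hD t) using 1
      ring
    have hmono : MonotoneOn (fun s => 2 * (mu - lam) * polarAngle s - (U mu s - U lam s))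
        (Set.Iic t₀) :=
      monotoneOn_of_hasDerivWithinAt_nonneg (convex_Iic t₀)
        (fun x _ => (hF x).continuousAt.continuousWithinAt)
        (fun x _ => (hF x).hasDerivWithinAt) fun x hx => by
          have hx' : x ≤ t₀ := interior_subset (s := Set.Iic t₀) hx
          exact neg_nonneg.2 (mul_nonpos_of_nonpos_of_nonneg
            ((ht₀ x hx').1.1 _ _ (hη' lam hl (hlm.trans hr) x hx')
              (hη' mu (hl.trans hlm) hr x hx')) (hD0 x))
    have hlim : Tendsto (fun s => 2 * (mu - lam) * polarAngle s - (U mu s - U lam s)) atBot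
        (𝓝 0) := by
      simpa using (tendsto_polarAngle_atBot.const_mul (2 * (mu - lam))).sub
        ((hU mu).tendsto.sub (hU lam).tendsto)
    have h := le_of_tendsto hlim ((eventually_le_atBot t₀).mono
      fun s hs => hmono hs Set.self_mem_Iic hs)
    have := mul_le_mul_of_nonneg_left (polarAngle_lt_pi t₀).le (mul_nonneg zero_le_two hδ)
    linarith
  -- Grönwall from t₀ to 0: adding 2 (mu - lam) to the difference absorbs the forcing, since L ≥ 1.
  have hF : ∀ t, HasDerivAt
      (fun s => (U mu s - U lam s + 2 * (mu - lam)) * Real.exp (-L * s))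
      ((rateSlope a E κ t (U lam t) (U mu t) * (U mu t - U lam t) +
        2 * (mu - lam) * Real.sin (polarAngle t) -
        L * (U mu t - U lam t + 2 * (mu - lam))) * Real.exp (-L * t)) t := fun t => by
    have he : HasDerivAt (fun s => Real.exp (-L * s)) (Real.exp (-L * t) * -L) t := by
      simpa using ((hasDerivAt_id t).const_mul (-L)).exp
    convert! ((hD t).add_const (2 * (mu - lam))).mul he using 1
    ring
  have hanti : Antitone fun s => (U mu s - U lam s + 2 * (mu - lam)) * Real.exp (-L * s) :=
    antitone_of_hasDerivAt_nonpos hF fun t => by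
      refine mul_nonpos_of_nonpos_of_nonneg ?_ (Real.exp_pos _).le
      have hs := (abs_le.1 (abs_rateSlope_le (a := a) (κ := κ) hE t (U lam t) (U mu t))).2
      have h3 : rateSlope a E κ t (U lam t) (U mu t) * (U mu t - U lam t) ≤
          L * (U mu t - U lam t) := mul_le_mul_of_nonneg_right (by linarith) (hD0 t)
      have h4 : 2 * (mu - lam) * Real.sin (polarAngle t) ≤ 2 * (mu - lam) :=
        mul_le_of_le_one_right (by linarith) (Real.sin_le_one _)
      have h5 : 2 * (mu - lam) ≤ L * (2 * (mu - lam)) :=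
        le_mul_of_one_le_left (by linarith) (by linarith [abs_nonneg κ, abs_nonneg a])
      linarith
  have h := hanti ht₀0
  simp only [mul_zero, Real.exp_zero, mul_one] at h
  have h6 := mul_le_mul_of_nonneg_right hleft (Real.exp_pos (-L * t₀)).le
  nlinarith

theorem continuous_value_zero (hE : E ∈ Set.Icc (0 : ℝ) 1) (hκ : 0 < κ) {U : ℝ → ℝ → ℝ}
    (hU : ∀ lam, IsUnstableSolution a E κ lam (U lam)) : Continuous fun lam => U lam 0 := by
  refine continuous_iff_continuousAt.2 fun lam => ?_
  obtain ⟨C, hC⟩ := exists_lipschitz_bound hE hκ hU (lam - 1) (lam + 1)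
  refine continuousAt_of_locally_lipschitz one_pos C fun mu hmu => ?_
  rw [Real.dist_eq, abs_lt] at hmu
  rw [Real.dist_eq, Real.dist_eq]
  rcases le_total lam mu with h | h
  · rw [abs_of_nonneg (sub_nonneg.2 h),
      abs_of_nonneg (sub_nonneg.2 ((hU lam).le_of_le hκ h (hU mu) 0))]
    exact hC lam mu (by linarith) h (by linarith)
  · rw [abs_of_nonpos (sub_nonpos.2 h), neg_sub,
      abs_of_nonpos (sub_nonpos.2 ((hU mu).le_of_le hκ h (hU lam) 0)), neg_sub]
    exact hC mu lam (by linarith) h (by linarith)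

/-! ### Reflection symmetry and the choice of the parameter -/

/-- The symmetry `(t, Θ) ↦ (-t, T - Θ)` of the equation, for `T` an odd multiple of `π`. -/
theorem IsSolution.reflect {u : ℝ → ℝ} (hu : IsSolution a E κ lam u) {T : ℝ}
    (hsin : Real.sin T = 0) (hcos : Real.cos T = -1) :
    IsSolution a E κ lam fun t => T - u (-t) := fun t => by
  have h := ((hu (-t)).scomp t (hasDerivAt_neg t)).const_sub T
  convert! h using 1
  simp only [angularRate, thetaField, polarAngle_neg, Real.sin_pi, Real.cos_pi,
    Real.sin_sub, Real.cos_sub, hsin, hcos, smul_eq_mul]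
  ring

/-- If u tends to T, its reflection is again an unstable solution, hence equals u, and T/2 is the
fixed value at time 0. Conversely, u(0) = T/2 makes u and its reflection agree at time 0, hence
everywhere. -/
theorem IsUnstableSolution.tendsto_atTop_iff (hκ : 0 < κ) {u : ℝ → ℝ}
    (hu : IsUnstableSolution a E κ lam u) {T : ℝ} (hsin : Real.sin T = 0)
    (hcos : Real.cos T = -1) : Tendsto u atTop (𝓝 T) ↔ u 0 = T / 2 := by
  have hr := hu.isSolution.reflect hsin hcos
  constructor
  · intro h
    have hr0 : Tendsto (fun t => T - u (-t)) atBot (𝓝 0) := by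
      simpa using (h.comp tendsto_neg_atBot_atTop).const_sub T
    have := congrFun (hu.unique hκ ⟨hr, hr0⟩) 0
    simp only [neg_zero] at this
    linarith
  · intro h
    have he := hu.isSolution.eq_of_eq hr (s := 0) (by simp only [neg_zero]; linarith)
    rw [he]
    simpa using (hu.tendsto.comp tendsto_neg_atTop_atBot).const_sub T

theorem abs_sin_nat_mul_le (n : ℕ) (x : ℝ) : |Real.sin (n * x)| ≤ n * |Real.sin x| := by
  induction n with
  | zero => simp
  | succ n ih =>
    push_cast
    rw [add_mul, one_mul, Real.sin_add]
    refine (abs_add_le _ _).trans ?_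
    rw [abs_mul, abs_mul, add_mul, one_mul]
    exact add_le_add ((mul_le_of_le_one_right (abs_nonneg _) (Real.abs_cos_le_one x)).trans ih)
      (mul_le_of_le_one_left (abs_nonneg _) (Real.abs_cos_le_one _))

/-- For every `k ≥ 1` some unstable solution takes the value `k π / 2` at time `0`. -/
theorem exists_parameter (hE : E ∈ Set.Icc (0 : ℝ) 1) (hκ : 0 < κ) (a : ℝ) {k : ℕ} (hk : 1 ≤ k) :
    ∃ lam u, IsUnstableSolution a E κ lam u ∧ u 0 = k * Real.pi / 2 ∧
      κ + 1 / 2 - |a| ≤ lam ∧ lam ≤ k * (κ + 1 / 2) + |a| := by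
  choose U hU using exists_isUnstableSolution hE hκ a
  have hk' : (1 : ℝ) ≤ k := by exact_mod_cast hk
  have hpi := Real.pi_pos
  -- Here -2κ sin θ + 2 (λ + |a|) sin θ = sin θ, so θ itself is a supersolution.
  have hlo : U (κ + 1 / 2 - |a|) 0 ≤ k * Real.pi / 2 := by
    have h := (hU (κ + 1 / 2 - |a|)).le_of_supersolution hκ hasDerivAt_polarAngle
      tendsto_polarAngle_atBot (fun t => (angularRate_le hE t _).trans (by linarith)) 0
    rw [polarAngle_zero] at h
    nlinarith
  -- The function kθ is a subsolution: κ in the parameter pays for |sin kθ| ≤ k sin θ, and 1/2 for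
  -- its own speed k sin θ.
  have hhi : k * Real.pi / 2 ≤ U (k * (κ + 1 / 2) + |a|) 0 := by
    have h := (hU (k * (κ + 1 / 2) + |a|)).ge_of_subsolution hκ
      (fun t => (hasDerivAt_polarAngle t).const_mul (k : ℝ))
      (by simpa using tendsto_polarAngle_atBot.const_mul (k : ℝ))
      (fun t => le_trans ?_ (le_angularRate hE t _)) 0
    · rw [polarAngle_zero] at h
      linarith
    · have h1 := (abs_le.1 (abs_sin_nat_mul_le k (polarAngle t))).2
      rw [abs_of_pos (sin_polarAngle_pos t)] at h1
      nlinarith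
  have hle : κ + 1 / 2 - |a| ≤ k * (κ + 1 / 2) + |a| := by
    nlinarith [abs_nonneg a]
  obtain ⟨lam, hlam, h⟩ := intermediate_value_Icc hle
    (continuous_value_zero hE hκ hU).continuousOn ⟨hlo, hhi⟩
  exact ⟨lam, U lam, hU lam, h, hlam.1, hlam.2⟩

/-! ### From scalar solutions to orbits on the cylinder -/

/-- Moving the left saddle to `Θ = 0` turns the parameters `(a, κ)` into `(a', κ')`, with
`κ' > 0`. -/
structure IsNormalization (a E κ a' κ' : ℝ) : Prop where
  pos : 0 < κ'
  saddleRight_eq : saddleRight κ = saddleLeft κ - Real.pi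
  nodeRight_eq : nodeRight κ = saddleLeft κ
  field_eq : ∀ lam x y, (thetaField a E κ lam (x, saddleLeft κ + y)).2 =
    (thetaField a' E κ' lam (x, y)).2

theorem isNormalization_of_pos (a E : ℝ) (hκ : 0 < κ) : IsNormalization a E κ a κ where
  pos := hκ
  saddleRight_eq := by simp [saddleRight, saddleLeft, hκ]
  nodeRight_eq := by simp [nodeRight, saddleLeft, hκ]
  field_eq := by simp [saddleLeft, hκ]

theorem isNormalization_of_neg (a E : ℝ) (hκ : κ < 0) : IsNormalization a E κ (-a) (-κ) where
  pos := neg_pos.2 hκ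
  saddleRight_eq := by simp [saddleRight, saddleLeft, hκ.not_gt]
  nodeRight_eq := by simp [nodeRight, saddleLeft, hκ.not_gt]
  field_eq lam x y := by
    simp only [saddleLeft, hκ.not_gt, if_false, thetaField, add_comm Real.pi y, Real.cos_add_pi,
      Real.sin_add_pi]
    ring

namespace IsNormalization

variable {a' κ' : ℝ}

theorem emanatesFromSaddle (hn : IsNormalization a E κ a' κ') {u : ℝ → ℝ}
    (hu : IsUnstableSolution a' E κ' lam u) :
    EmanatesFromSaddle a E κ lam fun t => (polarAngle t, saddleLeft κ + u t) := by
  refine ⟨⟨fun t => ?_, fun t => ⟨(polarAngle_pos t).le, (polarAngle_lt_pi t).le⟩,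
    fun h => (polarAngle_pos 0).ne' (h 0), fun h => (polarAngle_lt_pi 0).ne (h 0)⟩, ?_⟩
  · have h := (hasDerivAt_polarAngle t).prodMk ((hu.isSolution t).const_add (saddleLeft κ))
    rw [angularRate, ← hn.field_eq] at h
    exact h
  · have h := tendsto_polarAngle_atBot.prodMk_nhds (hu.tendsto.const_add (saddleLeft κ))
    rwa [add_zero] at h

theorem exists_unstableSolution (hn : IsNormalization a E κ a' κ') {γ : ℝ → ℝ × ℝ}
    (hγ : EmanatesFromSaddle a E κ lam γ) :
    ∃ u c, IsUnstableSolution a' E κ' lam u ∧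
      ∀ t, γ t = (polarAngle (t + c), saddleLeft κ + u (t + c)) := by
  obtain ⟨⟨hd, hmem, h0, hπ⟩, hlim⟩ := hγ
  have hd1 : ∀ t, HasDerivAt (fun s => (γ s).1) (thetaField a E κ lam (γ t)).1 t := fun t =>
    (hasFDerivAt_fst (𝕜 := ℝ) (p := γ t)).comp_hasDerivAt t (hd t)
  have hd2 : ∀ t, HasDerivAt (fun s => (γ s).2) (thetaField a E κ lam (γ t)).2 t := fun t =>
    (hasFDerivAt_snd (𝕜 := ℝ) (p := γ t)).comp_hasDerivAt t (hd t)
  obtain ⟨c, hc⟩ := exists_eq_polarAngle_shift hd1 hmem h0 hπ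
  refine ⟨fun t => (γ (t - c)).2 - saddleLeft κ, c, ⟨fun t => ?_, ?_⟩, fun t => ?_⟩
  · have h := ((hd2 (t - c)).comp_sub_const t c).sub_const (saddleLeft κ)
    convert! h using 1
    rw [angularRate, ← hn.field_eq, add_sub_cancel]
    congr 2
    rw [Prod.ext_iff]
    simp [hc]
  · have h2 := (continuous_snd.tendsto _).comp
      (hlim.comp (tendsto_atBot_add_const_right atBot (-c) tendsto_id))
    simpa [Function.comp_def, sub_eq_add_neg] using h2.sub_const (saddleLeft κ)
  · rw [Prod.ext_iff]
    simp [hc]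

theorem isSaddlesConnectorWithWinding_iff (hn : IsNormalization a E κ a' κ') (N : ℤ) :
    IsSaddlesConnectorWithWinding a E κ lam N ↔ ∃ u, IsUnstableSolution a' E κ' lam u ∧
      Tendsto u atTop (𝓝 (-Real.pi - 2 * Real.pi * N)) := by
  constructor
  · rintro ⟨γ, ⟨hγ, -⟩, hend, hw⟩
    obtain ⟨u, c, hu, hγu⟩ := hn.exists_unstableSolution hγ
    refine ⟨u, hu, ?_⟩
    have hlim : Tendsto γ atTop (𝓝 (Real.pi, saddleRight κ - 2 * Real.pi * N)) := by
      -- Parity: the lifts of N⁺ and S⁺ differ by odd multiples of π, so they never project to the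
      -- same point.
      refine hw.resolve_left fun hnode => ?_
      have h1 := (Real.Angle.continuous_coe.tendsto _).comp
        ((continuous_snd.tendsto _).comp hnode)
      have h2 := tendsto_nhds_unique h1 ((continuous_snd.tendsto _).comp hend)
      simp only [hn.nodeRight_eq, hn.saddleRight_eq, Real.Angle.angle_eq_iff_two_pi_dvd_sub] at h2
      obtain ⟨k, hk⟩ := h2
      have h3 : (1 : ℝ) = 2 * (k + N) := by
        refine mul_left_cancel₀ Real.pi_ne_zero ?_
        linear_combination hk
      have h4 : (1 : ℤ) = 2 * (k + N) := by exact_mod_cast h3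
      omega
    have h2 := (continuous_snd.tendsto _).comp
      (hlim.comp (tendsto_atTop_add_const_right atTop (-c) tendsto_id))
    have h3 := h2.sub_const (saddleLeft κ)
    simp only [hn.saddleRight_eq, Function.comp_def, hγu, id, neg_add_cancel_right,
      add_sub_cancel_left] at h3
    convert! h3 using 2
    ring
  · rintro ⟨u, hu, hlim⟩
    have hlim' : Tendsto (fun t => (polarAngle t, saddleLeft κ + u t)) atTop
        (𝓝 (Real.pi, saddleRight κ - 2 * Real.pi * N)) := by
      convert! tendsto_polarAngle_atTop.prodMk_nhds (hlim.const_add (saddleLeft κ)) using 3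
      rw [hn.saddleRight_eq]
      ring
    refine ⟨_, ⟨hn.emanatesFromSaddle hu, fun γ hγ => ?_⟩, ?_, Or.inr hlim'⟩
    · obtain ⟨v, c, hv, hγv⟩ := hn.exists_unstableSolution hγ
      exact ⟨c, fun t => by rw [hγv, hv.unique hn.pos hu]⟩
    · have hcont : Continuous fun p : ℝ × ℝ => (p.1, (p.2 : Real.Angle)) :=
        continuous_fst.prodMk (Real.Angle.continuous_coe.comp continuous_snd)
      have h := (hcont.tendsto _).comp hlim'
      have hangle : ((saddleRight κ - 2 * Real.pi * N : ℝ) : Real.Angle) = saddleRight κ := by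
        rw [Real.Angle.angle_eq_iff_two_pi_dvd_sub]
        exact ⟨-N, by push_cast; ring⟩
      rw [hangle] at h
      exact h

theorem isSaddlesConnectorWithWinding_iff_value (hn : IsNormalization a E κ a' κ') (N : ℤ) :
    IsSaddlesConnectorWithWinding a E κ lam N ↔ ∃ u, IsUnstableSolution a' E κ' lam u ∧
      u 0 = (-2 * N - 1) * Real.pi / 2 := by
  rw [hn.isSaddlesConnectorWithWinding_iff]
  have e : (-Real.pi - 2 * Real.pi * N) = -Real.pi - N * (2 * Real.pi) := by ring
  have hsin : Real.sin (-Real.pi - 2 * Real.pi * N) = 0 := by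
    rw [e, Real.sin_sub_int_mul_two_pi]; simp
  have hcos : Real.cos (-Real.pi - 2 * Real.pi * N) = -1 := by
    rw [e, Real.cos_sub_int_mul_two_pi]; simp
  refine exists_congr fun u => and_congr_right fun hu => ?_
  rw [hu.tendsto_atTop_iff hn.pos hsin hcos]
  ring_nf

theorem exists_connector (hn : IsNormalization a E κ a' κ') (hE : E ∈ Set.Icc (0 : ℝ) 1)
    {N : ℤ} (hN : N ≤ -1) :
    ∃ lamN : ℝ,
      (IsSaddlesConnectorWithWinding a E κ lamN N ∧
        ∀ lam : ℝ, IsSaddlesConnectorWithWinding a E κ lam N → lam = lamN) ∧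
      (∀ lam : ℝ, IsSaddlesConnectorWithWinding a E κ lam (N + 1) → lamN ≥ lam) ∧
      κ' + 1 / 2 - |a'| ≤ lamN ∧ lamN ≤ (-2 * N - 1) * (κ' + 1 / 2) + |a'| := by
  obtain ⟨k, hk⟩ : ∃ k : ℕ, (k : ℤ) = -2 * N - 1 := ⟨(-2 * N - 1).toNat, by omega⟩
  have hk' : (k : ℝ) = -2 * N - 1 := by exact_mod_cast hk
  obtain ⟨lamN, u, hu, hu0, hlo, hhi⟩ := exists_parameter hE hn.pos a' (k := k) (by omega)
  rw [hk'] at hu0 hhi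
  refine ⟨lamN, ⟨(hn.isSaddlesConnectorWithWinding_iff_value N).2 ⟨u, hu, hu0⟩,
    fun lam h => ?_⟩, fun lam h => ?_, hlo, hhi⟩
  · obtain ⟨v, hv, hv0⟩ := (hn.isSaddlesConnectorWithWinding_iff_value N).1 h
    rcases lt_trichotomy lam lamN with hlt | heq | hlt
    · linarith [hv.lt_of_lt hn.pos hlt hu 0]
    · exact heq
    · linarith [hu.lt_of_lt hn.pos hlt hv 0]
  -- The target at time 0 for N + 1 lies π below that for N. Existence for N + 1 is not needed, so N
  -- = -1 is covered.
  · obtain ⟨v, hv, hv0⟩ := (hn.isSaddlesConnectorWithWinding_iff_value (N + 1)).1 h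
    by_contra! hlt
    have := hu.lt_of_lt hn.pos hlt hv 0
    push_cast at hv0
    linarith [Real.pi_pos]

end IsNormalization

end ThetaSystem

theorem mainTheorem5 (a E κ : ℝ) (ha : 0 < a) (hE : E ∈ Set.Icc (0 : ℝ) 1)
    (hκ : ∃ m : ℤ, κ = (m : ℝ) + 1 / 2) (N : ℤ) (hN : N ≤ -1) :
    ∃ lamN : ℝ,
      (IsSaddlesConnectorWithWinding a E κ lamN N ∧
        ∀ lam : ℝ, IsSaddlesConnectorWithWinding a E κ lam N → lam = lamN) ∧
      (∀ lam : ℝ, IsSaddlesConnectorWithWinding a E κ lam (N + 1) → lamN ≥ lam) ∧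
      (0 < κ → (2 * (N : ℝ) + 1) * (1 / 2 + κ) - 2 * a ≤ -lamN ∧ -lamN ≤ -(1 / 2) - κ + a) ∧
      (κ < 0 → (2 * (N : ℝ) + 1) * (1 / 2 - κ) - 2 * a ≤ -lamN ∧ -lamN ≤ -(1 / 2) + κ + a) := by
  have hκ0 : κ ≠ 0 := by
    obtain ⟨m, rfl⟩ := hκ
    intro h
    have h1 : (2 : ℝ) * m + 1 = 0 := by linarith
    have h2 : 2 * m + 1 = 0 := by exact_mod_cast h1
    omega
  rcases hκ0.lt_or_gt with hneg | hpos
  · obtain ⟨lamN, hc, hle, hlo, hhi⟩ :=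
      (ThetaSystem.isNormalization_of_neg a E hneg).exists_connector hE hN
    -- The bound obtained on -λ_N from below contains -a, which is stronger than the required -2a.
    rw [abs_neg, abs_of_pos ha] at hlo hhi
    exact ⟨lamN, hc, hle, fun h => absurd h hneg.not_gt,
      fun _ => ⟨by linarith, by linarith⟩⟩
  · obtain ⟨lamN, hc, hle, hlo, hhi⟩ :=
      (ThetaSystem.isNormalization_of_pos a E hpos).exists_connector hE hN
    rw [abs_of_pos ha] at hlo hhi
    exact ⟨lamN, hc, hle, fun _ => ⟨by linarith, by linarith⟩,
      fun h => absurd h hpos.not_gt⟩
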